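/- Let $\lambda_P>0$, $\lambda_S\ge 0$, $r_g\ge 0$, $r_1>0$, $P_t>0$, $\alpha>2$, $\sigma_P^2\ge 0$, $\beta_P\ge 0$. The typical primary receiver is at the origin of $\mathbb{R}^2$ and the typical primary transmitter (PT) at a point $x_1$ with $\|x_1\|=r_1$. The energy receivers form a homogeneous Poisson point process (PPP) $\Phi_S$ of density $\lambda_S$, $R_e$ is the distance from $x_1$ to the nearest point of $\Phi_S$ ($R_e=\infty$ if $\Phi_S=\emptyset$), and $P_{\rm active}=\mathbb{P}(R_e\ge r_g)$. The interfering PTs $x_2,x_3,\dots$ (each listed once) form a homogeneous PPP of density $\lambda_P$. The fading gains $h_1,h_2,\dots$ are i.i.d. exponential with mean $1$. Let $\delta_i\in\{0,1\}$ be the activity indicator of the $i$-th PT, with $\delta_1=\mathbb{1}(R_e\ge r_g)$ and $\mathbb{P}(\delta_i=1)=P_{\rm active}$ for all $i$. Under the approximation that the correlation of the activity indicators is ignored, that is, $\delta_1,\delta_2,\dots$ are independent and the sequences $(x_i)$, $(h_i)$, $(\delta_i)$ are mutually independent, one has $P_{\rm active}=e^{-\lambda_S\pi r_g^2}$, the active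 interfering PTs $\{x_i: i\ge 2,\ \delta_i=1\}$ form a homogeneous PPP of density $\lambda_P e^{-\lambda_S\pi r_g^2}$, and with $$\mathrm{SINR}_P=\frac{P_t h_1 r_1^{-\alpha}}{\sum_{i\ge 2}\delta_i P_t h_i\|x_i\|^{-\alpha}+\sigma_P^2}$$ the probability of successful connection $P_{\rm con}=\mathbb{P}(R_e\ge r_g,\ \mathrm{SINR}_P\ge\beta_P)$ is $$P_{\rm con}=\exp\left(-\left[\lambda_S\pi r_g^2+\beta_P\frac{\sigma_P^2}{P_t}r_1^{\alpha}+\frac{2\pi^2\lambda_P P_{\rm active}\,\beta_P^{2/\alpha}r_1^2}{\alpha\sin(2\pi/\alpha)}\right]\right).$$ -/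

import Mathlib

open MeasureTheory ProbabilityTheory
open scoped ENNReal NNReal

/-- The Euclidean plane. -/
abbrev Plane : Type := EuclideanSpace ℝ (Fin 2)

/-- The random set `Φ` is a homogeneous Poisson point process in the plane with density `lam ≥ 0`:
the number of points in a set of finite area is Poisson with mean `lam` times the area, and the
numbers of points in pairwise disjoint sets are independent. -/
structure IsHomogeneousPPP {Ω : Type*} [MeasurableSpace Ω] (μ : Measure Ω)
    (lam : ℝ) (Φ : Ω → Set Plane) : Prop where
  hasLaw_count : ∀ B : Set Plane, MeasurableSet B → volume B ≠ ∞ →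
    HasLaw (fun ω => (Φ ω ∩ B).encard)
      ((poissonMeasure (lam.toNNReal * (volume B).toNNReal)).map (Nat.cast : ℕ → ℕ∞)) μ
  indep_count : ∀ (n : ℕ) (B : Fin n → Set Plane), (∀ j, MeasurableSet (B j)) →
    (∀ j, volume (B j) ≠ ∞) → Pairwise (fun j k => Disjoint (B j) (B k)) →
    iIndepFun (fun j ω => (Φ ω ∩ B j).encard) μ

/-- Distance (in `[0, ∞]`, and `∞` if there are no receivers) from the typical transmitter at `x₁`
to the nearest energy receiver. -/
noncomputable def nearestERDist {Ω : Type*} (x₁ : Plane) (ΦS : Ω → Set Plane) (ω : Ω) : ℝ≥0∞ :=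
  Metric.infEDist x₁ (ΦS ω)

/-- `P_active`: the probability that the guard zone of radius `rg` of the typical transmitter is
clear of energy receivers. -/
noncomputable def activeProb {Ω : Type*} [MeasurableSpace Ω] (μ : Measure Ω) (rg : ℝ)
    (x₁ : Plane) (ΦS : Ω → Set Plane) : ℝ :=
  μ.real {ω | ENNReal.ofReal rg ≤ nearestERDist x₁ ΦS ω}

/-- The SINR at the typical receiver, which is at the origin, with values in `[0, ∞]`.
Index `0` is the typical transmitter, the indices `i + 1` are the interferers; `x`, `h`, `δ` are
positions, fading gains and activity indicators. -/
noncomputable def sinrP {Ω : Type*} (Pt α σ2 : ℝ) (x : ℕ → Ω → Plane) (h : ℕ → Ω → ℝ)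
    (δ : ℕ → Ω → Bool) (ω : Ω) : ℝ≥0∞ :=
  ENNReal.ofReal (Pt * h 0 ω * ‖x 0 ω‖ ^ (-α)) /
    ((∑' i : ℕ, if δ (i + 1) ω = true then
        ENNReal.ofReal (Pt * h (i + 1) ω * ‖x (i + 1) ω‖ ^ (-α)) else 0)
      + ENNReal.ofReal σ2)

/-- Probability of successful connection: the typical transmitter is active and the SINR at the
typical receiver is at least `βP`. -/
noncomputable def connProb {Ω : Type*} [MeasurableSpace Ω] (μ : Measure Ω)
    (Pt α σ2 βP rg : ℝ) (ΦS : Ω → Set Plane) (x₁ : Plane)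
    (x : ℕ → Ω → Plane) (h : ℕ → Ω → ℝ) (δ : ℕ → Ω → Bool) : ℝ :=
  μ.real {ω | ENNReal.ofReal rg ≤ nearestERDist x₁ ΦS ω ∧
    ENNReal.ofReal βP ≤ sinrP Pt α σ2 x h δ ω}

/-- The network seen from the typical receiver at the origin, under the approximation that
correlations of the activity indicators are ignored. -/
structure IsIndependentActivityNetwork {Ω : Type*} [MeasurableSpace Ω] (μ : Measure Ω)
    (lamP lamS rg : ℝ) (x₁ : Plane) (ΦS : Ω → Set Plane)
    (x : ℕ → Ω → Plane) (h : ℕ → Ω → ℝ) (δ : ℕ → Ω → Bool) : Prop where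
  measurable_x : ∀ i, Measurable (x i)
  measurable_h : ∀ i, Measurable (h i)
  measurable_δ : ∀ i, Measurable (δ i)
  /-- The energy receivers form a Poisson point process. -/
  ppp_S : IsHomogeneousPPP μ lamS ΦS
  /-- The typical transmitter is at `x₁`. -/
  x_zero : ∀ ω, x 0 ω = x₁
  /-- The interferers form a Poisson point process, in which each point is listed once. -/
  ppp_P : IsHomogeneousPPP μ lamP (fun ω => Set.range fun i : ℕ => x (i + 1) ω)
  inj_x : ∀ᵐ ω ∂μ, Function.Injective fun i : ℕ => x (i + 1) ω
  /-- Rayleigh fading: i.i.d. exponential gains with mean one. -/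
  law_h : ∀ i, HasLaw (h i) (expMeasure 1) μ
  indep_h : iIndepFun h μ
  /-- The typical transmitter is active if and only if its guard zone is clear. -/
  δ_zero : ∀ ω, δ 0 ω = true ↔ ENNReal.ofReal rg ≤ nearestERDist x₁ ΦS ω
  /-- Every transmitter is active with the same probability `P_active`. -/
  prob_δ : ∀ i, μ.real {ω | δ i ω = true} = activeProb μ rg x₁ ΦS
  /-- The activity indicators (that of the typical transmitter included) are independent. -/
  indep_δ : iIndepFun δ μ
  /-- Positions, gains and activity indicators are mutually independent. -/
  indep_h_δ : IndepFun (fun ω i => h i ω) (fun ω i => δ i ω) μ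
  indep_x_hδ : IndepFun (fun ω i => x i ω) (fun ω => (fun i => h i ω, fun i => δ i ω)) μ

/-! ### Integration against independent variables. -/

section Independence

variable {Ω : Type*} [MeasurableSpace Ω] {μ : Measure Ω}
  {E F G : Type*} [MeasurableSpace E] [MeasurableSpace F] [MeasurableSpace G]

/-! The typical transmitter is active exactly when an open disc contains no energy receiver, so
$p=P_{\rm active}$ is a Poisson void probability.

For the connection probability, put $s=\beta_P r_1^\alpha$ and $b=\beta_P\sigma_P^2 r_1^\alpha/P_t$.
The SINR condition reads $h_1\ge b+\sum_{i\ge2}\delta_i s\|x_i\|^{-\alpha}h_i$. The exponential tail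
of $h_1$ makes the sum a product. Averaging over the other gains, then over the marks, leaves
$e^{-b}\,p\,\mathbb{E}\prod_{i\ge2}(1-p\,\ell(x_i))$ with
$\ell(q)=s\|q\|^{-\alpha}/(1+s\|q\|^{-\alpha})$ (`measureReal_active_and_sum_le_gain`). The
generating functional $\mathbb{E}\prod(1-u(x_i))=e^{-\lambda\int u}$ (`tendsto_integral_prod`)
reduces the expectation to $\int\ell$, which a Laplace transform and Euler's reflection formula
evaluate (`lintegral_plane_inv_one_add_rpow`).

For the thinning, averaging over the marks replaces $z$ by $1+p(z-1)$ in the generating function of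
the counts, which multiplies the density by $p$. Taking $z=e^{it}$ gives characteristic functions,
and these determine both the laws and the independence of the counts.

Infinite sums and products enter as limits over the first $n$ interferers. The connection event is a
decreasing intersection of its truncations, and the generating functional is likewise stated as a
limit. -/

theorem indepFun_prodMk_of_indepFun_prodMk [IsProbabilityMeasure μ] {A : Ω → E} {B : Ω → F} {C : Ω → G}
    (hA : Measurable A) (hB : Measurable B) (hC : Measurable C)
    (h₁ : IndepFun A (fun ω => (B ω, C ω)) μ) (h₂ : IndepFun B C μ) :
    IndepFun B (fun ω => (A ω, C ω)) μ := by
  have hAC : IndepFun A C μ := h₁.comp (φ := id) (ψ := Prod.snd) measurable_id measurable_snd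
  rw [indepFun_iff_map_prod_eq_prod_map_map (by fun_prop) (by fun_prop)] at h₁ h₂ hAC ⊢
  have hpA := Measure.isProbabilityMeasure_map (μ := μ) hA.aemeasurable
  have hpB := Measure.isProbabilityMeasure_map (μ := μ) hB.aemeasurable
  have hpC := Measure.isProbabilityMeasure_map (μ := μ) hC.aemeasurable
  rw [hAC]
  rw [h₂] at h₁
  have := Measure.isProbabilityMeasure_map (μ := μ) (f := fun ω => (B ω, A ω, C ω)) (by fun_prop)
  -- Boxes determine the joint law, and on a box both sides are the same product of three marginals.
  refine Measure.ext_prod₃ fun {s t u} hs ht hu => ?_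
  have key := congrArg (fun m => m (t ×ˢ (s ×ˢ u))) h₁
  simp only [Measure.prod_prod] at key ⊢
  rw [Measure.map_apply (by fun_prop) (by measurability)] at key ⊢
  rw [show (fun ω => (B ω, (A ω, C ω))) ⁻¹' (s ×ˢ t ×ˢ u) =
    (fun ω => (A ω, (B ω, C ω))) ⁻¹' (t ×ˢ s ×ˢ u) by ext; simp; tauto, key]
  ring

/-- Fubini for the product law; it plays the role of conditioning on `X`. -/
theorem integral_comp_prodMk_of_indepFun [IsProbabilityMeasure μ] {𝕜 : Type*} [RCLike 𝕜] {X : Ω → E} {Y : Ω → F}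
    (hX : Measurable X) (hY : Measurable Y) (h : IndepFun X Y μ) {f : E → F → 𝕜}
    (hf : Measurable fun q : E × F => f q.1 q.2) {c : ℝ} (hc : ∀ a b, ‖f a b‖ ≤ c) :
    ∫ ω, f (X ω) (Y ω) ∂μ = ∫ ω, ∫ ω', f (X ω) (Y ω') ∂μ ∂μ := by
  have hpX := Measure.isProbabilityMeasure_map (μ := μ) hX.aemeasurable
  have hpY := Measure.isProbabilityMeasure_map (μ := μ) hY.aemeasurable
  have h1 := integral_map (μ := μ) (φ := fun ω => (X ω, Y ω)) (by fun_prop)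
    (f := fun q : E × F => f q.1 q.2) hf.aestronglyMeasurable
  rw [h.map_prod_eq_prod_map_map (by fun_prop) (by fun_prop)] at h1
  rw [← h1, integral_prod]
  · rw [integral_map hX.aemeasurable]
    · congr 1 with ω
      rw [integral_map hY.aemeasurable]
      exact (hf.comp measurable_prodMk_left).aestronglyMeasurable
    · exact (hf.stronglyMeasurable.integral_prod_right).aestronglyMeasurable
  · exact Integrable.of_bound hf.aestronglyMeasurable c (.of_forall fun q => hc _ _)

theorem integral_finset_prod_of_iIndepFun {𝕜 : Type*} [RCLike 𝕜] {ι : Type*} {Y : ι → Ω → F}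
    (hY : ∀ i, Measurable (Y i)) (h : iIndepFun Y μ) (s : Finset ι) {f : ι → F → 𝕜}
    (hf : ∀ i, Measurable (f i)) :
    ∫ ω, ∏ i ∈ s, f i (Y i ω) ∂μ = ∏ i ∈ s, ∫ ω, f i (Y i ω) ∂μ := by
  have h' := h.precomp (g := ((↑) : s → ι)) Subtype.val_injective
  have := h'.integral_fun_prod_comp (f := fun i : s => f i) (fun i => (hY i).aemeasurable)
    (fun i => (hf i).aestronglyMeasurable)
  simpa only [Finset.prod_coe_sort s fun i => ∫ ω, f i (Y i ω) ∂μ,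
    fun ω => Finset.prod_coe_sort s fun i => f i (Y i ω)] using this

/-- Once `X` is frozen, the marks are still independent with unchanged laws, so the inner integral
factors. -/
theorem integral_finset_prod_marks [IsProbabilityMeasure μ] {𝕜 : Type*} [RCLike 𝕜] {ι : Type*} [Countable ι]
    {X : Ω → E} {Y : ι → Ω → F} (hX : Measurable X) (hY : ∀ i, Measurable (Y i))
    (hind : iIndepFun Y μ) (hXY : IndepFun X (fun ω i => Y i ω) μ) (s : Finset ι)
    {f : ι → E → F → 𝕜} (hf : ∀ i, Measurable fun q : E × F => f i q.1 q.2)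
    (hb : ∀ i a b, ‖f i a b‖ ≤ 1) :
    ∫ ω, ∏ i ∈ s, f i (X ω) (Y i ω) ∂μ = ∫ ω, ∏ i ∈ s, ∫ ω', f i (X ω) (Y i ω') ∂μ ∂μ := by
  rw [integral_comp_prodMk_of_indepFun (f := fun a (y : ι → F) => ∏ i ∈ s, f i a (y i)) hX
    (measurable_pi_lambda _ hY) hXY _ (c := 1)]
  · congr 1 with ω
    exact integral_finset_prod_of_iIndepFun hY hind s
      fun i => (hf i).comp measurable_prodMk_left
  · intro a b
    rw [norm_prod]
    exact Finset.prod_le_one (fun _ _ => norm_nonneg _) fun i _ => hb i _ _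
  · refine Finset.measurable_fun_prod _ fun i _ => ?_
    exact (hf i).comp (f := fun q : E × (ι → F) => (q.1, q.2 i)) (by fun_prop)

end Independence

/-! ### Exponential gains: tail and Laplace transform. -/

section Exponential

variable {Ω : Type*} [MeasurableSpace Ω] {μ : Measure Ω}

theorem integral_comp_of_hasLaw_exp {X : Ω → ℝ} (hX : HasLaw X (expMeasure 1) μ) {f : ℝ → ℝ}
    (hf : Measurable f) :
    ∫ ω, f (X ω) ∂μ = ∫ t in Set.Ioi 0, Real.exp (-t) * f t := by
  have h1 := hX.integral_comp (f := f) hf.aestronglyMeasurable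
  simp only [Function.comp_def] at h1
  have hm : Measurable (gammaPDF 1 1) := (measurable_gammaPDFReal 1 1).ennreal_ofReal
  rw [h1, expMeasure, gammaMeasure, integral_withDensity_eq_integral_toReal_smul hm
    (.of_forall fun _ => ENNReal.ofReal_lt_top), ← integral_Ici_eq_integral_Ioi,
    ← integral_indicator measurableSet_Ici]
  congr 1 with t
  by_cases ht : 0 ≤ t
  · rw [Set.indicator_of_mem (Set.mem_Ici.2 ht), gammaPDF_of_nonneg ht,
      ENNReal.toReal_ofReal] <;> simp [Real.exp_nonneg]
  · rw [Set.indicator_of_notMem (by simpa using ht), gammaPDF_of_neg (not_le.1 ht)]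
    simp

theorem measureReal_le_of_hasLaw_exp [IsProbabilityMeasure μ] {X : Ω → ℝ} (hX : HasLaw X (expMeasure 1) μ)
    (hm : Measurable X) {b : ℝ} (hb : 0 ≤ b) : μ.real {ω | b ≤ X ω} = Real.exp (-b) := by
  rw [← integral_indicator_one (measurableSet_le measurable_const hm)]
  have := integral_comp_of_hasLaw_exp hX (f := (Set.Ici b).indicator 1)
    (measurable_one.indicator measurableSet_Ici)
  refine Eq.trans (by rfl) (this.trans ?_)
  rw [← integral_Ici_eq_integral_Ioi]
  have h2 : ∀ t, Real.exp (-t) * (Set.Ici b).indicator 1 t =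
      (Set.Ici b).indicator (fun t => Real.exp (-t)) t := fun t => by
    by_cases h : b ≤ t <;> simp [Set.indicator, h]
  simp_rw [h2]
  rw [setIntegral_indicator measurableSet_Ici, Set.inter_eq_self_of_subset_right
    (Set.Ici_subset_Ici.2 hb), integral_Ici_eq_integral_Ioi, integral_exp_neg_Ioi]

theorem ae_nonneg_of_hasLaw_exp [IsProbabilityMeasure μ] {X : Ω → ℝ} (hX : HasLaw X (expMeasure 1) μ)
    (hm : Measurable X) : ∀ᵐ ω ∂μ, 0 ≤ X ω := by
  have h := measureReal_le_of_hasLaw_exp hX hm le_rfl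
  rw [neg_zero, Real.exp_zero] at h
  rw [ae_iff_measure_eq, measure_univ]
  · exact (ENNReal.toReal_eq_one_iff _).1 h
  · exact (measurableSet_le measurable_const hm).nullMeasurableSet

theorem integral_exp_neg_mul_of_hasLaw_exp {X : Ω → ℝ} (hX : HasLaw X (expMeasure 1) μ)
    {a : ℝ} (ha : 0 ≤ a) : ∫ ω, Real.exp (-(a * X ω)) ∂μ = (1 + a)⁻¹ := by
  rw [integral_comp_of_hasLaw_exp hX (f := fun t => Real.exp (-(a * t))) (by fun_prop)]
  have := integral_exp_mul_Ioi (a := -(1 + a)) (by linarith) 0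
  rw [mul_zero, Real.exp_zero, neg_div_neg_eq, one_div] at this
  rw [← this]
  congr 1 with t
  rw [← Real.exp_add]
  ring_nf

/-- Given the other gains, the tail of `h 0` is the exponential of minus a sum, hence a product of
independent factors. Each one averages to a Laplace transform. -/
theorem measureReal_add_sum_le_exp [IsProbabilityMeasure μ] {h : ℕ → Ω → ℝ} (hm : ∀ i, Measurable (h i))
    (hlaw : ∀ i, HasLaw (h i) (expMeasure 1) μ) (hind : iIndepFun h μ) {b : ℝ} (hb : 0 ≤ b)
    {a : ℕ → ℝ} (ha : ∀ i, 0 ≤ a i) (n : ℕ) :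
    μ.real {ω | b + ∑ i ∈ Finset.range n, a i * h (i + 1) ω ≤ h 0 ω} =
      Real.exp (-b) * ∏ i ∈ Finset.range n, (1 + a i)⁻¹ := by
  have hS : Measurable fun ω => b + ∑ i ∈ Finset.range n, a i * h (i + 1) ω := by fun_prop
  have hind' : IndepFun (fun ω => b + ∑ i ∈ Finset.range n, a i * h (i + 1) ω) (h 0) μ := by
    have := hind.indepFun_finset ((Finset.range n).image (· + 1)) {0} (by simp) hm
    have hmem (i : Finset.range n) : (i : ℕ) + 1 ∈ (Finset.range n).image (· + 1) :=
      Finset.mem_image_of_mem _ i.2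
    refine this.comp (φ := fun y => b + ∑ i : Finset.range n, a i * y ⟨i + 1, hmem i⟩)
      (ψ := fun y => y ⟨0, by simp⟩) (by fun_prop) (measurable_pi_apply _) |>.congr (.of_forall fun ω => ?_) (.of_forall fun ω => rfl)
    simp only [Function.comp_apply]
    rw [Finset.sum_coe_sort (Finset.range n) fun i => a i * h (i + 1) ω]
  have h1 := integral_comp_prodMk_of_indepFun (𝕜 := ℝ) hS (hm 0) hind'
    (f := fun u v => Set.indicator {q : ℝ × ℝ | q.1 ≤ q.2} 1 (u, v))
    (by
      exact measurable_one.indicator (measurableSet_le measurable_fst measurable_snd)) (c := 1)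
    (fun u v => by
      by_cases h : u ≤ v <;> simp [Set.indicator, h])
  have h2 : ∀ (u : Ω → ℝ), Measurable u → ∫ ω, Set.indicator {q : ℝ × ℝ | q.1 ≤ q.2} 1 (u ω, h 0 ω) ∂μ
      = μ.real {ω | u ω ≤ h 0 ω} := fun u hu => by
    rw [← integral_indicator_one (measurableSet_le hu (hm 0))]
    rfl
  rw [h2 _ hS] at h1
  rw [h1]
  -- The tail is `exp (-t)` only for `t ≥ 0`, so the other gains must be nonnegative.
  have h3 : ∀ᵐ ω ∂μ, ∀ i, 0 ≤ h i ω := ae_all_iff.2 fun i => ae_nonneg_of_hasLaw_exp (hlaw i) (hm i)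
  have h4 : ∀ᵐ ω ∂μ, ∫ ω', Set.indicator {q : ℝ × ℝ | q.1 ≤ q.2} 1
      (b + ∑ i ∈ Finset.range n, a i * h (i + 1) ω, h 0 ω') ∂μ =
      Real.exp (-b) * ∏ i ∈ Finset.range n, Real.exp (-(a i * h (i + 1) ω)) := by
    filter_upwards [h3] with ω hω
    rw [h2 (fun _ => _) measurable_const, measureReal_le_of_hasLaw_exp (hlaw 0) (hm 0),
      ← Real.exp_sum, ← Real.exp_add, Finset.sum_neg_distrib, neg_add]
    exact add_nonneg hb (Finset.sum_nonneg fun i _ => mul_nonneg (ha i) (hω _))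
  rw [integral_congr_ae h4, integral_const_mul,
    integral_finset_prod_of_iIndepFun (fun i => hm (i + 1))
      (hind.precomp (g := (· + 1)) (add_left_injective 1)) _
      (f := fun i y => Real.exp (-(a i * y))) (by fun_prop)]
  simp_rw [integral_exp_neg_mul_of_hasLaw_exp (hlaw _) (ha _)]

end Exponential

/-! ### Void probability and generating functional of a Poisson process. -/

section PoissonProcess

open Filter Topology

open scoped Classical in
theorem eventually_card_filter_range_eq_ncard {A : Set ℕ} (hA : A.Finite) :
    ∀ᶠ n in atTop, ((Finset.range n).filter (· ∈ A)).card = A.ncard := by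
  obtain ⟨m, hm⟩ := hA.bddAbove
  filter_upwards [eventually_gt_atTop m] with n hn
  rw [Set.ncard_eq_toFinset_card A hA]
  congr 1
  ext i
  simp only [Finset.mem_filter, Finset.mem_range, Set.Finite.mem_toFinset, and_iff_right_iff_imp]
  exact fun hi => (hm hi).trans_lt hn

open scoped Classical in
theorem eventually_prod_range_ite_eq_pow {M : Type*} [CommMonoid M] {A : Set ℕ} (hA : A.Finite)
    (z : M) :
    ∀ᶠ n in atTop, ∏ i ∈ Finset.range n, (if i ∈ A then z else 1) = z ^ A.ncard := by
  filter_upwards [eventually_card_filter_range_eq_ncard hA] with n hn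
  rw [Finset.prod_ite, Finset.prod_const, Finset.prod_const_one, mul_one, hn]

variable {Ω : Type*} [MeasurableSpace Ω] {μ : Measure Ω}

/-- The argument `z` is complex so that points of the unit circle can be inserted later. The junk
value of `toNat` at `⊤` is harmless: the law lives on `ℕ`. -/
theorem integral_pow_toNat_of_hasLaw_poisson {X : Ω → ℕ∞} {r : ℝ≥0}
    (hX : HasLaw X ((poissonMeasure r).map (Nat.cast : ℕ → ℕ∞)) μ) (z : ℂ) :
    ∫ ω, z ^ (X ω).toNat ∂μ = Complex.exp (r * (z - 1)) := by
  have h := hX.integral_comp (f := fun k : ℕ∞ => z ^ k.toNat) .of_discrete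
  simp only [Function.comp_def] at h
  rw [h, integral_map_cast_poissonMeasure]
  have h2 := ((NormedSpace.expSeries_div_hasSum_exp ((r : ℂ) * z)).mul_left
    (Complex.exp (-r))).tsum_eq
  rw [← Complex.exp_eq_exp_ℂ, ← Complex.exp_add] at h2
  rw [show (r : ℂ) * (z - 1) = -r + r * z by ring, ← h2]
  congr 1 with n
  rw [Complex.real_smul]
  push_cast
  rw [ENat.toNat_natCast]
  ring

theorem ae_lt_top_of_hasLaw_poisson {X : Ω → ℕ∞} {r : ℝ≥0}
    (hX : HasLaw X ((poissonMeasure r).map (Nat.cast : ℕ → ℕ∞)) μ) : ∀ᵐ ω ∂μ, X ω ≠ ⊤ := by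
  refine (hX.ae_iff (p := fun k => k ≠ ⊤) .of_discrete).2 ?_
  rw [ae_map_iff .of_discrete .of_discrete]
  exact .of_forall fun n => ENat.natCast_ne_top n

theorem encard_range_inter {α β : Type*} {f : α → β} (hf : f.Injective) (B : Set β) :
    (Set.range f ∩ B).encard = (f ⁻¹' B).encard := by
  rw [← Set.image_preimage_eq_range_inter, hf.encard_image]

theorem norm_prod_ite_le_one {ι : Type*} (s : Finset ι) (p : ι → Prop) [DecidablePred p]
    {z : ι → ℂ} (hz : ∀ j, ‖z j‖ ≤ 1) : ‖∏ j ∈ s, (if p j then z j else 1)‖ ≤ 1 := by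
  rw [norm_prod]
  refine Finset.prod_le_one (fun _ _ => norm_nonneg _) fun j _ => ?_
  split_ifs
  exacts [hz j, by simp]

variable {lam : ℝ} {y : ℕ → Ω → Plane}

theorem IsHomogeneousPPP.ae_finite_preimage (hy : ∀ᵐ ω ∂μ, Function.Injective fun i => y i ω)
    (hP : IsHomogeneousPPP μ lam fun ω => Set.range fun i => y i ω) {B : Set Plane}
    (hB : MeasurableSet B) (hfin : volume B ≠ ∞) :
    ∀ᵐ ω ∂μ, {i | y i ω ∈ B}.Finite := by
  filter_upwards [hy, ae_lt_top_of_hasLaw_poisson (hP.hasLaw_count B hB hfin)] with ω h1 h2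
  rw [encard_range_inter h1] at h2
  exact Set.encard_ne_top_iff.1 h2

theorem IsHomogeneousPPP.measureReal_inter_eq_empty {Φ : Ω → Set Plane} (hP : IsHomogeneousPPP μ lam Φ)
    (hlam : 0 ≤ lam) {B : Set Plane} (hB : MeasurableSet B) (hfin : volume B ≠ ∞) :
    μ.real {ω | Φ ω ∩ B = ∅} = Real.exp (-(lam * volume.real B)) := by
  have h := (hP.hasLaw_count B hB hfin).measureReal_eq (p := fun k => k = 0) (.of_discrete)
  simp only [Set.encard_eq_zero] at h
  rw [h, map_measureReal_apply .of_discrete .of_discrete]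
  have : (Nat.cast : ℕ → ℕ∞) ⁻¹' {k | k = 0} = {0} := by ext; simp
  rw [this, poissonMeasure_real_singleton]
  simp [Real.coe_toNNReal _ hlam, measureReal_def, ← ENNReal.coe_toNNReal_eq_toReal]

theorem activeProb_eq_exp {lam : ℝ} (hlam : 0 ≤ lam) {r : ℝ} (hr : 0 ≤ r) (p : Plane)
    {Φ : Ω → Set Plane} (hP : IsHomogeneousPPP μ lam Φ) :
    activeProb μ r p Φ = Real.exp (-(lam * Real.pi * r ^ 2)) := by
  -- The inequality is not strict, so the empty disc is the open one.
  have h : {ω | ENNReal.ofReal r ≤ nearestERDist p Φ ω} = {ω | Φ ω ∩ Metric.ball p r = ∅} := by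
    ext ω
    simp only [nearestERDist, Metric.le_infEDist, Set.mem_ofPred_eq, Set.eq_empty_iff_forall_notMem,
      Set.mem_inter_iff, Metric.mem_ball, not_and, not_lt]
    refine forall₂_congr fun q _ => ?_
    rw [edist_dist, ENNReal.ofReal_le_ofReal_iff dist_nonneg, dist_comm]
  have hv : volume (Metric.ball p r) = ENNReal.ofReal (r ^ 2 * Real.pi) := by
    rw [EuclideanSpace.volume_ball_fin_two, ← ENNReal.ofReal_pow hr,
      ← ENNReal.ofReal_mul (by positivity)]
  rw [activeProb, h, hP.measureReal_inter_eq_empty hlam measurableSet_ball (by simp [hv]),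
    measureReal_def, hv, ENNReal.toReal_ofReal (by positivity)]
  ring_nf

variable [IsProbabilityMeasure μ]

theorem tendsto_integral_of_eventually_eq {f : ℕ → Ω → ℂ} {g : Ω → ℂ}
    (hf : ∀ n, Measurable (f n)) (hb : ∀ n ω, ‖f n ω‖ ≤ 1)
    (h : ∀ᵐ ω ∂μ, ∀ᶠ n in atTop, f n ω = g ω) :
    Tendsto (fun n => ∫ ω, f n ω ∂μ) atTop (𝓝 (∫ ω, g ω ∂μ)) :=
  tendsto_integral_of_dominated_convergence (fun _ => 1) (fun n => (hf n).aestronglyMeasurable)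
    (integrable_const _) (fun n => .of_forall (hb n))
    (h.mono fun _ hω => tendsto_const_nhds.congr' (hω.mono fun _ h => h.symm))

namespace IsHomogeneousPPP

open scoped Classical in
-- Almost surely only finitely many indices land in the sets `B j`, so the products are eventually
-- constant, equal to the product of the `z j` raised to the counts. These counts are independent
-- Poisson variables.
theorem tendsto_integral_prod_ite (hlam : 0 ≤ lam) (hym : ∀ i, Measurable (y i))
    (hy : ∀ᵐ ω ∂μ, Function.Injective fun i => y i ω)
    (hP : IsHomogeneousPPP μ lam fun ω => Set.range fun i => y i ω)
    {ι : Type*} [Fintype ι] {B : ι → Set Plane} (hB : ∀ j, MeasurableSet (B j))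
    (hfin : ∀ j, volume (B j) ≠ ∞) (hd : Pairwise fun j k => Disjoint (B j) (B k))
    {z : ι → ℂ} (hz : ∀ j, ‖z j‖ ≤ 1) :
    Tendsto (fun n => ∫ ω, ∏ i ∈ Finset.range n, ∏ j, (if y i ω ∈ B j then z j else 1) ∂μ) atTop
      (𝓝 (Complex.exp (∑ j, lam * volume.real (B j) * (z j - 1)))) := by
  have hind : iIndepFun (fun j ω => ((Set.range fun i => y i ω) ∩ B j).encard) μ := by
    let e := Fintype.equivFin ι
    have := (hP.indep_count _ (fun k => B (e.symm k)) (fun k => hB _) (fun k => hfin _)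
      (fun k l hkl => hd (e.symm.injective.ne hkl))).precomp e.injective
    simpa using this
  have hcount := fun j => hP.hasLaw_count (B j) (hB j) (hfin j)
  have h1 : Complex.exp (∑ j, lam * volume.real (B j) * (z j - 1)) =
      ∫ ω, ∏ j, z j ^ ((Set.range fun i => y i ω) ∩ B j).encard.toNat ∂μ := by
    rw [hind.integral_fun_prod_comp (f := fun j (k : ℕ∞) => z j ^ k.toNat)
      (fun j => (hcount j).aemeasurable) (fun j => .of_discrete), Complex.exp_sum]
    refine Finset.prod_congr rfl fun j _ => ?_
    rw [integral_pow_toNat_of_hasLaw_poisson (hcount j)]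
    congr 2
    simp [Real.coe_toNNReal _ hlam, measureReal_def, ← ENNReal.coe_toNNReal_eq_toReal]
  rw [h1]
  refine tendsto_integral_of_eventually_eq (fun n => ?_) (fun n ω => ?_) ?_
  · exact Finset.measurable_fun_prod _ fun i _ => Finset.measurable_fun_prod _ fun j _ =>
      Measurable.ite (hym i (hB j)) measurable_const measurable_const
  · rw [norm_prod]
    exact Finset.prod_le_one (fun _ _ => norm_nonneg _) fun i _ => norm_prod_ite_le_one _ _ hz
  · filter_upwards [hy, ae_all_iff.2 fun j => ae_finite_preimage hy hP (hB j) (hfin j)]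
      with ω h2 h3
    filter_upwards [eventually_all.2 fun j => eventually_prod_range_ite_eq_pow (h3 j) (z j)]
      with n hn
    rw [Finset.prod_comm]
    refine Finset.prod_congr rfl fun j _ => (hn j).trans ?_
    -- Injectivity of the listing equates the number of points with the number of indices.
    rw [encard_range_inter h2]
    rfl

/-- The fibres of `s` over its nonzero values `c` are disjoint sets of finite area, to be weighted
by `z = 1 - c`. The value `0` must be left out, as its fibre has infinite area, and it would only
give factors `1`. -/
theorem tendsto_integral_prod_one_sub_simpleFunc (hlam : 0 ≤ lam) (hym : ∀ i, Measurable (y i))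
    (hy : ∀ᵐ ω ∂μ, Function.Injective fun i => y i ω)
    (hP : IsHomogeneousPPP μ lam fun ω => Set.range fun i => y i ω)
    (s : SimpleFunc Plane ℝ) (h0 : ∀ p, 0 ≤ s p) (h1 : ∀ p, s p ≤ 1)
    (hs : Integrable s volume) :
    Tendsto (fun n => ∫ ω, ∏ i ∈ Finset.range n, (1 - s (y i ω)) ∂μ) atTop
      (𝓝 (Real.exp (-(lam * ∫ p, s p)))) := by
  classical
  have key := tendsto_integral_prod_ite hlam hym hy hP (ι := ↥(s.range.filter (· ≠ 0)))
    (B := fun c => s ⁻¹' {c.1}) (fun c => s.measurableSet_fiber _)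
    (fun c => (SimpleFunc.measure_preimage_lt_top_of_integrable s hs
      (Finset.mem_filter.1 c.2).2).ne)
    (fun c d hcd => (Set.disjoint_iff_inter_eq_empty.2 (by
      ext p
      simp only [Set.mem_inter_iff, Set.mem_preimage, Set.mem_singleton_iff,
        Set.mem_empty_iff_false, iff_false, not_and]
      exact fun h h' => hcd (Subtype.ext (h.symm.trans h')))))
    (z := fun c => ((1 - c.1 : ℝ) : ℂ)) (fun c => by
      obtain ⟨c, hc⟩ := c
      obtain ⟨p, rfl⟩ := SimpleFunc.mem_range.1 (Finset.mem_filter.1 hc).1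
      rw [Complex.norm_real, Real.norm_eq_abs, abs_le]
      exact ⟨by linarith [h1 p], by linarith [h0 p]⟩)
  have h2 : ∀ p, ∏ c : ↥(s.range.filter (· ≠ 0)), (if p ∈ s ⁻¹' {c.1} then ((1 - c.1 : ℝ) : ℂ) else 1) =
      ((1 - s p : ℝ) : ℂ) := fun p => by
    rw [Finset.prod_coe_sort (s.range.filter (· ≠ 0))
      (fun c => if p ∈ s ⁻¹' {c} then ((1 - c : ℝ) : ℂ) else 1)]
    simp only [Set.mem_preimage, Set.mem_singleton_iff]
    rw [Finset.prod_ite_eq]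
    by_cases h : s p = 0 <;> simp [h]
  have h3 : (∑ c : ↥(s.range.filter (· ≠ 0)), (lam : ℂ) * volume.real (s ⁻¹' {c.1}) * (((1 - c.1 : ℝ) : ℂ) - 1)) =
      ((-(lam * ∫ p, s p) : ℝ) : ℂ) := by
    rw [Finset.sum_coe_sort (s.range.filter (· ≠ 0))
      (fun c => (lam : ℂ) * volume.real (s ⁻¹' {c}) * (((1 - c : ℝ) : ℂ) - 1)),
      ← SimpleFunc.integral_eq_integral s hs, SimpleFunc.integral_eq_sum_filter]
    push_cast
    rw [Finset.mul_sum, ← Finset.sum_neg_distrib]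
    refine Finset.sum_congr rfl fun c _ => ?_
    simp only [smul_eq_mul]
    push_cast
    ring
  simp_rw [h2, h3] at key
  rw [← Complex.ofReal_exp] at key
  simp_rw [← Complex.ofReal_prod] at key
  rw [← Filter.tendsto_ofReal_iff]
  simpa only [integral_complex_ofReal] using key

/-- Approximate `u` from below by simple functions. The products for `u` are at most those for `s
k`, which bounds the limit from above. For fixed `n`, the integral for `s k` decreases in `n`, so it
is at least its limit; letting `k → ∞` gives the lower bound. No double limit is interchanged. -/
theorem tendsto_integral_prod (hlam : 0 ≤ lam) (hym : ∀ i, Measurable (y i))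
    (hy : ∀ᵐ ω ∂μ, Function.Injective fun i => y i ω)
    (hP : IsHomogeneousPPP μ lam fun ω => Set.range fun i => y i ω)
    {u : Plane → ℝ} (hu : Measurable u) (h0 : ∀ p, 0 ≤ u p) (h1 : ∀ p, u p ≤ 1)
    (hint : Integrable u volume) :
    Tendsto (fun n => ∫ ω, ∏ i ∈ Finset.range n, (1 - u (y i ω)) ∂μ) atTop
      (𝓝 (Real.exp (-(lam * ∫ p, u p)))) := by
  let s : ℕ → SimpleFunc Plane ℝ := fun k =>
    (SimpleFunc.eapprox (fun p => ENNReal.ofReal (u p)) k).map ENNReal.toReal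
  have hs0 : ∀ k p, 0 ≤ s k p := fun k p => ENNReal.toReal_nonneg
  have hsu : ∀ k p, s k p ≤ u p := fun k p => by
    refine ENNReal.toReal_le_of_le_ofReal (h0 p) ?_
    exact (le_iSup (fun k => SimpleFunc.eapprox (fun p => ENNReal.ofReal (u p)) k p) k).trans_eq
      (SimpleFunc.iSup_eapprox_apply hu.ennreal_ofReal p)
  have hst : ∀ p, Tendsto (fun k => s k p) atTop (𝓝 (u p)) := fun p => by
    have := SimpleFunc.tendsto_eapprox (f := fun p => ENNReal.ofReal (u p)) hu.ennreal_ofReal p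
    have := (ENNReal.tendsto_toReal ENNReal.ofReal_ne_top).comp this
    rwa [ENNReal.toReal_ofReal (h0 p)] at this
  have hsi : ∀ k, Integrable (s k) volume := fun k =>
    hint.mono' (s k).measurable.aestronglyMeasurable (.of_forall fun p => by
      rw [Real.norm_of_nonneg (hs0 k p)]
      exact hsu k p)
  have hs := fun k => tendsto_integral_prod_one_sub_simpleFunc hlam hym hy hP (s k) (hs0 k)
    (fun p => (hsu k p).trans (h1 p)) (hsi k)
  have hR : Tendsto (fun k => Real.exp (-(lam * ∫ p, s k p))) atTop
      (𝓝 (Real.exp (-(lam * ∫ p, u p)))) := by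
    refine (Real.continuous_exp.tendsto _).comp ((Tendsto.const_mul _ ?_).neg)
    exact tendsto_integral_of_dominated_convergence u
      (fun k => (s k).measurable.aestronglyMeasurable) hint
      (fun k => .of_forall fun p => by
        rw [Real.norm_of_nonneg (hs0 k p)]
        exact hsu k p) (.of_forall hst)
  have hprod : ∀ (v : Plane → ℝ), Measurable v → (∀ p, 0 ≤ v p) → (∀ p, v p ≤ 1) → ∀ n,
      (∀ ω, 0 ≤ ∏ i ∈ Finset.range n, (1 - v (y i ω))) ∧
      (∀ ω, ∏ i ∈ Finset.range n, (1 - v (y i ω)) ≤ 1) ∧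
      Measurable (fun ω => ∏ i ∈ Finset.range n, (1 - v (y i ω))) := fun v hv hv0 hv1 n =>
    ⟨fun ω => Finset.prod_nonneg fun i _ => by linarith [hv1 (y i ω)],
      fun ω => Finset.prod_le_one (fun i _ => by linarith [hv1 (y i ω)])
        fun i _ => by linarith [hv0 (y i ω)], by fun_prop⟩
  have hprodi : ∀ (v : Plane → ℝ), Measurable v → (∀ p, 0 ≤ v p) → (∀ p, v p ≤ 1) → ∀ n,
      Integrable (fun ω => ∏ i ∈ Finset.range n, (1 - v (y i ω))) μ := fun v hv hv0 hv1 n => by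
    obtain ⟨ha, hb, hc⟩ := hprod v hv hv0 hv1 n
    exact .of_bound hc.aestronglyMeasurable 1 (.of_forall fun ω => by
      rw [Real.norm_of_nonneg (ha ω)]
      exact hb ω)
  have hle : ∀ n k, ∫ ω, ∏ i ∈ Finset.range n, (1 - u (y i ω)) ∂μ ≤
      ∫ ω, ∏ i ∈ Finset.range n, (1 - s k (y i ω)) ∂μ := fun n k =>
    integral_mono (hprodi u hu h0 h1 n)
      (hprodi (s k) (s k).measurable (hs0 k) (fun p => (hsu k p).trans (h1 p)) n)
      fun ω => Finset.prod_le_prod (fun i _ => by linarith [h1 (y i ω)])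
        fun i _ => by linarith [hsu k (y i ω)]
  have hge : ∀ n, Real.exp (-(lam * ∫ p, u p)) ≤
      ∫ ω, ∏ i ∈ Finset.range n, (1 - u (y i ω)) ∂μ := fun n => by
    have hlim : Tendsto (fun k => ∫ ω, ∏ i ∈ Finset.range n, (1 - s k (y i ω)) ∂μ) atTop
        (𝓝 (∫ ω, ∏ i ∈ Finset.range n, (1 - u (y i ω)) ∂μ)) := by
      refine tendsto_integral_of_dominated_convergence (fun _ => 1) (fun k => ?_)
        (integrable_const _) (fun k => .of_forall fun ω => ?_) (.of_forall fun ω => ?_)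
      · exact (hprodi (s k) (s k).measurable (hs0 k) (fun p => (hsu k p).trans (h1 p)) n).1
      · obtain ⟨ha, hb, hc⟩ :=
          hprod (s k) (s k).measurable (hs0 k) (fun p => (hsu k p).trans (h1 p)) n
        rw [Real.norm_of_nonneg (ha ω)]
        exact hb ω
      · exact tendsto_finsetProd _ fun i _ => (hst _).const_sub 1
    refine le_of_tendsto_of_tendsto' hR hlim fun k => ?_
    refine Antitone.le_of_tendsto (antitone_nat_of_succ_le fun m => ?_) (hs k) n
    refine integral_mono
      (hprodi (s k) (s k).measurable (hs0 k) (fun p => (hsu k p).trans (h1 p)) _)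
      (hprodi (s k) (s k).measurable (hs0 k) (fun p => (hsu k p).trans (h1 p)) _) fun ω => ?_
    obtain ⟨ha, -, -⟩ := hprod (s k) (s k).measurable (hs0 k) (fun p => (hsu k p).trans (h1 p)) m
    simp only
    rw [Finset.prod_range_succ]
    exact mul_le_of_le_one_right (ha ω) (by linarith [hs0 k (y m ω)])
  refine tendsto_order.2 ⟨fun a ha => .of_forall fun n => ha.trans_le (hge n), fun a ha => ?_⟩
  obtain ⟨k, hk⟩ := (hR.eventually (gt_mem_nhds ha)).exists
  filter_upwards [(hs k).eventually (gt_mem_nhds hk)] with n hn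
  exact (hle n k).trans_lt hn

end IsHomogeneousPPP

end PoissonProcess

/-! ### Independent thinning. -/

section Thinning

open Filter Topology

variable {Ω : Type*} [MeasurableSpace Ω] {μ : Measure Ω}
variable {lam p : ℝ} {y : ℕ → Ω → Plane} {d : ℕ → Ω → Bool}

/-- The number of retained points in `B`. -/
noncomputable def thinnedCount (y : ℕ → Ω → Plane) (d : ℕ → Ω → Bool) (B : Set Plane) (ω : Ω) : ℕ :=
  {i | d i ω = true ∧ y i ω ∈ B}.ncard

/-- The floor exhibits the extended count as a measurable function of a real variable, the form to
which characteristic functions apply. -/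
theorem IsHomogeneousPPP.ae_encard_thinned_eq (hy : ∀ᵐ ω ∂μ, Function.Injective fun i => y i ω)
    (hP : IsHomogeneousPPP μ lam fun ω => Set.range fun i => y i ω)
    {B : Set Plane} (hB : MeasurableSet B) (hfin : volume B ≠ ∞) :
    (fun ω => ({q | ∃ i, d i ω = true ∧ y i ω = q} ∩ B).encard) =ᵐ[μ]
      fun ω => ((⌊(thinnedCount y d B ω : ℝ)⌋₊ : ℕ) : ℕ∞) := by
  filter_upwards [hy, ae_finite_preimage hy hP hB hfin] with ω h2 h3
  have h4 : {i | d i ω = true ∧ y i ω ∈ B}.Finite := h3.subset fun i hi => hi.2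
  rw [Nat.floor_natCast, thinnedCount, h4.cast_ncard_eq, ← h2.encard_image]
  congr 1
  ext q
  simp only [Set.mem_inter_iff, Set.mem_ofPred_eq, Set.mem_image]
  constructor
  · rintro ⟨⟨i, hi, rfl⟩, hq⟩
    exact ⟨i, ⟨hi, hq⟩, rfl⟩
  · rintro ⟨i, ⟨hi, hq⟩, rfl⟩
    exact ⟨⟨i, hi, rfl⟩, hq⟩

theorem IsHomogeneousPPP.aemeasurable_thinnedCount (hym : ∀ i, Measurable (y i))
    (hy : ∀ᵐ ω ∂μ, Function.Injective fun i => y i ω)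
    (hP : IsHomogeneousPPP μ lam fun ω => Set.range fun i => y i ω)
    (hdm : ∀ i, Measurable (d i)) {B : Set Plane} (hB : MeasurableSet B) (hfin : volume B ≠ ∞) :
    AEMeasurable (thinnedCount y d B) μ := by
  classical
  refine aemeasurable_of_tendsto_metrizable_ae (u := atTop)
    (f := fun n ω => ((Finset.range n).filter fun i => d i ω = true ∧ y i ω ∈ B).card)
    (fun n => ?_) ?_
  · simp_rw [Finset.card_filter]
    exact (Finset.measurable_fun_sum _ fun i _ => Measurable.ite
      ((hdm i (measurableSet_singleton true)).inter (hym i hB))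
        measurable_const measurable_const).aemeasurable
  · filter_upwards [ae_finite_preimage hy hP hB hfin] with ω h3
    refine tendsto_const_nhds.congr' ?_
    filter_upwards [eventually_card_filter_range_eq_ncard
      ((h3).subset fun i (hi : d i ω = true ∧ y i ω ∈ B) => hi.2)] with n hn
    refine hn.symm.trans (congrArg Finset.card ?_)
    exact Finset.filter_congr fun i _ => Iff.rfl

variable [IsProbabilityMeasure μ]

theorem integral_ite_eq_true {b : Ω → Bool} (hb : Measurable b) {𝕜 : Type*} [RCLike 𝕜] (c : 𝕜) :
    ∫ ω, (if b ω = true then c else 1) ∂μ = 1 + μ.real {ω | b ω = true} * (c - 1) := by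
  have hs : MeasurableSet {ω | b ω = true} := hb (measurableSet_singleton true)
  have h : ∀ ω, (if b ω = true then c else 1) =
      1 + Set.indicator {ω | b ω = true} (fun _ => c - 1) ω := fun ω => by
    by_cases h : b ω = true <;> simp [h]
  simp_rw [h]
  rw [integral_add (integrable_const _) ((integrable_const _).indicator hs),
    integral_indicator_const _ hs]
  simp [RCLike.real_smul_eq_coe_mul]

/-- This is a convex combination of `1` and `z`. -/
theorem norm_one_add_mul_sub_one_le {p : ℝ} (h0 : 0 ≤ p) (h1 : p ≤ 1) {z : ℂ} (hz : ‖z‖ ≤ 1) :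
    ‖1 + (p : ℂ) * (z - 1)‖ ≤ 1 := by
  rw [show 1 + (p : ℂ) * (z - 1) = ((1 - p : ℝ) : ℂ) + (p : ℂ) * z by push_cast; ring]
  refine (norm_add_le _ _).trans ?_
  rw [norm_mul, Complex.norm_of_nonneg (by linarith), Complex.norm_of_nonneg h0]
  nlinarith

open scoped Classical in
-- By disjointness at most one factor differs from `1`, so averaging over a mark acts on each factor
-- separately.
theorem one_add_mul_prod_ite_sub_one {ι α : Type*} [Fintype ι] {B : ι → Set α}
    (hd : Pairwise fun j k => Disjoint (B j) (B k)) (p : ℂ) (z : ι → ℂ) (a : α) :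
    1 + p * (∏ j, (if a ∈ B j then z j else 1) - 1) =
      ∏ j, (if a ∈ B j then 1 + p * (z j - 1) else 1) := by
  by_cases h : ∃ j, a ∈ B j
  · obtain ⟨j, hj⟩ := h
    have hne : ∀ k, k ≠ j → a ∉ B k := fun k hk hak =>
      Set.disjoint_left.1 (hd hk) hak hj
    rw [Finset.prod_eq_single j (fun k _ hk => if_neg (hne k hk)) (by simp),
      Finset.prod_eq_single j (fun k _ hk => if_neg (hne k hk)) (by simp), if_pos hj, if_pos hj]
  · push Not at h
    simp [h]

namespace IsHomogeneousPPP

theorem integral_prod_pow_thinnedCount (hlam : 0 ≤ lam) (hym : ∀ i, Measurable (y i))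
    (hy : ∀ᵐ ω ∂μ, Function.Injective fun i => y i ω)
    (hP : IsHomogeneousPPP μ lam fun ω => Set.range fun i => y i ω)
    (hdm : ∀ i, Measurable (d i)) (hd : iIndepFun d μ)
    (hyd : IndepFun (fun ω i => y i ω) (fun ω i => d i ω) μ)
    (hp : ∀ i, μ.real {ω | d i ω = true} = p)
    {ι : Type*} [Fintype ι] {B : ι → Set Plane} (hB : ∀ j, MeasurableSet (B j))
    (hfin : ∀ j, volume (B j) ≠ ∞) (hdisj : Pairwise fun j k => Disjoint (B j) (B k))
    {z : ι → ℂ} (hz : ∀ j, ‖z j‖ ≤ 1) :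
    ∫ ω, ∏ j, z j ^ thinnedCount y d (B j) ω ∂μ =
      Complex.exp (∑ j, (lam * p : ℝ) * volume.real (B j) * (z j - 1)) := by
  classical
  have hp0 : 0 ≤ p := hp 0 ▸ measureReal_nonneg
  have hp1 : p ≤ 1 := hp 0 ▸ measureReal_le_one
  have hlim := hP.tendsto_integral_prod_ite hlam hym hy hB hfin hdisj
    (z := fun j => 1 + p * (z j - 1)) fun j => norm_one_add_mul_sub_one_le hp0 hp1 (hz j)
  have hE : ∑ j, (lam : ℂ) * volume.real (B j) * (1 + p * (z j - 1) - 1) =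
      ∑ j, ((lam * p : ℝ) : ℂ) * volume.real (B j) * (z j - 1) :=
    Finset.sum_congr rfl fun j _ => by push_cast; ring
  rw [hE] at hlim
  refine tendsto_nhds_unique ?_ hlim
  -- Averaging over the mark of a point in `B j` turns its weight `z j` into `1 + p * (z j - 1)`.
  have hmarks : ∀ n, ∫ ω, ∏ i ∈ Finset.range n,
      ∏ j, (if y i ω ∈ B j then 1 + (p : ℂ) * (z j - 1) else 1) ∂μ =
      ∫ ω, ∏ i ∈ Finset.range n, ∏ j, (if d i ω = true ∧ y i ω ∈ B j then z j else 1) ∂μ := by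
    intro n
    have := integral_finset_prod_marks (μ := μ) (X := fun ω i => y i ω) (measurable_pi_lambda _ hym)
      hdm hd hyd (Finset.range n)
      (f := fun i (a : ℕ → Plane) (b : Bool) => ∏ j, (if b = true ∧ a i ∈ B j then z j else 1))
      (fun i => Finset.measurable_fun_prod _ fun j _ => Measurable.ite
        ((measurable_snd (measurableSet_singleton true)).inter
          (((measurable_pi_apply i).comp measurable_fst) (hB j))) measurable_const measurable_const)
      (fun i a b => norm_prod_ite_le_one _ _ hz)
    rw [this]
    congr 1 with ω
    refine Finset.prod_congr rfl fun i _ => ?_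
    rw [← one_add_mul_prod_ite_sub_one hdisj, ← hp i]
    refine (integral_ite_eq_true (hdm i) _).symm.trans (integral_congr_ae (.of_forall fun ω' => ?_))
    by_cases h : d i ω' = true <;> simp [h]
  simp_rw [hmarks]
  refine tendsto_integral_of_eventually_eq (fun n => ?_) (fun n ω => ?_) ?_
  · exact Finset.measurable_fun_prod _ fun i _ => Finset.measurable_fun_prod _ fun j _ =>
      Measurable.ite ((hdm i (measurableSet_singleton true)).inter (hym i (hB j)))
        measurable_const measurable_const
  · rw [norm_prod]
    exact Finset.prod_le_one (fun _ _ => norm_nonneg _) fun i _ => norm_prod_ite_le_one _ _ hz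
  · filter_upwards [ae_all_iff.2 fun j => ae_finite_preimage hy hP (hB j) (hfin j)] with ω h3
    filter_upwards [eventually_all.2 fun j => eventually_prod_range_ite_eq_pow
      ((h3 j).subset fun i (hi : d i ω = true ∧ y i ω ∈ B j) => hi.2) (z j)] with n hn
    rw [Finset.prod_comm]
    refine Finset.prod_congr rfl fun j _ => Eq.trans ?_ (hn j)
    exact Finset.prod_congr rfl fun i _ => if_congr Iff.rfl rfl rfl

/-- Independent thinning of a Poisson process: each point is retained with probability `p`. -/
theorem thinning (hlam : 0 ≤ lam) (hym : ∀ i, Measurable (y i))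
    (hy : ∀ᵐ ω ∂μ, Function.Injective fun i => y i ω)
    (hP : IsHomogeneousPPP μ lam fun ω => Set.range fun i => y i ω)
    (hdm : ∀ i, Measurable (d i)) (hd : iIndepFun d μ)
    (hyd : IndepFun (fun ω i => y i ω) (fun ω i => d i ω) μ)
    (hp : ∀ i, μ.real {ω | d i ω = true} = p) :
    IsHomogeneousPPP μ (lam * p) fun ω => {q | ∃ i, d i ω = true ∧ y i ω = q} := by
  have hp0 : 0 ≤ p := hp 0 ▸ measureReal_nonneg
  have hnorm : ∀ t : ℝ, ‖Complex.exp (t * Complex.I)‖ ≤ 1 := fun t =>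
    (Complex.norm_exp_ofReal_mul_I t).le
  have hmeas : ∀ {B : Set Plane}, MeasurableSet B → volume B ≠ ∞ →
      AEMeasurable (fun ω => (thinnedCount y d B ω : ℝ)) μ := fun hB hfin =>
    measurable_from_nat.comp_aemeasurable (aemeasurable_thinnedCount hym hy hP hdm hB hfin)
  -- The generating function at a point of the unit circle is the characteristic function of the
  -- count.
  have hchar : ∀ {B : Set Plane}, MeasurableSet B → volume B ≠ ∞ → ∀ t : ℝ,
      charFun (μ.map fun ω => (thinnedCount y d B ω : ℝ)) t =
        Complex.exp ((lam * p : ℝ) * volume.real B * (Complex.exp (t * Complex.I) - 1)) := by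
    intro B hB hfin t
    have := integral_prod_pow_thinnedCount hlam hym hy hP hdm hd hyd hp (ι := Unit)
      (B := fun _ => B) (fun _ => hB) (fun _ => hfin) (fun j k hjk => (hjk rfl).elim)
      (z := fun _ => Complex.exp (t * Complex.I)) (fun _ => hnorm t)
    simp only [Finset.univ_unique, Finset.prod_singleton, Finset.sum_singleton] at this
    rw [← this, charFun_apply_real, integral_map (hmeas hB hfin) (by fun_prop)]
    congr 1 with ω
    rw [← Complex.exp_nat_mul]
    congr 1
    push_cast
    ring
  have hfloor : Measurable fun r : ℝ => ((⌊r⌋₊ : ℕ) : ℕ∞) :=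
    measurable_from_nat.comp Nat.measurable_floor
  refine ⟨fun B hB hfin => ?_, fun n B hB hfin hdisj => ?_⟩
  · refine HasLaw.congr ?_ (ae_encard_thinned_eq hy hP hB hfin)
    have hlaw : μ.map (fun ω => (thinnedCount y d B ω : ℝ)) =
        (poissonMeasure ((lam * p).toNNReal * (volume B).toNNReal)).map (Nat.cast : ℕ → ℝ) := by
      have := Measure.isProbabilityMeasure_map (μ := μ) (hmeas hB hfin)
      refine Measure.ext_of_charFun (funext fun t => ?_)
      rw [hchar hB hfin, charFun_map_cast_poissonMeasure]
      congr 2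
      simp [Real.coe_toNNReal _ (mul_nonneg hlam hp0), measureReal_def,
        ← ENNReal.coe_toNNReal_eq_toReal]
    refine ⟨hfloor.comp_aemeasurable (hmeas hB hfin), ?_⟩
    have := AEMeasurable.map_map_of_aemeasurable (μ := μ) hfloor.aemeasurable (hmeas hB hfin)
    rw [Function.comp_def] at this
    rw [← this, hlaw, Measure.map_map hfloor measurable_from_nat]
    congr 1
    ext k
    simp
  · refine iIndepFun.congr
      (fun j => (ae_encard_thinned_eq hy hP (hB j) (hfin j)).symm) ?_
    refine iIndepFun.comp (f := fun j ω => (thinnedCount y d (B j) ω : ℝ)) ?_ _ fun _ => hfloor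
    -- Independence holds because the joint characteristic function is the product of the marginal
    -- ones: the exponent is a sum over `j`.
    refine (iIndepFun_iff_charFun_pi fun j => hmeas (hB j) (hfin j)).2 fun t => ?_
    simp_rw [hchar (hB _) (hfin _)]
    rw [← Complex.exp_sum, ← integral_prod_pow_thinnedCount hlam hym hy hP hdm hd hyd hp hB hfin
      hdisj fun j => hnorm (t j), charFun_apply, integral_map]
    · congr 1 with ω
      rw [PiLp.inner_apply]
      push_cast
      rw [Finset.sum_mul, Complex.exp_sum]
      refine Finset.prod_congr rfl fun j _ => ?_
      rw [← Complex.exp_nat_mul]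
      congr 1
      simp
      ring
    · exact (PiLp.continuous_toLp _ _).measurable.comp_aemeasurable
        (aemeasurable_pi_lambda _ fun j => hmeas (hB j) (hfin j))
    · fun_prop

end IsHomogeneousPPP

end Thinning

/-! ### The plane integral of the interference loss. -/

section PathLoss

theorem integral_plane_exp_neg_mul_rpow {α b : ℝ} (hα : 1 ≤ α) (hb : 0 < b) :
    ∫ q : Plane, Real.exp (-b * ‖q‖ ^ α) =
      Real.pi * b ^ (-2 / α) * Real.Gamma (2 / α + 1) := by
  rw [← Complex.integral_exp_neg_mul_rpow hα hb,
    ← (Complex.orthonormalBasisOneI.measurePreserving_repr).integral_comp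
      Complex.orthonormalBasisOneI.repr.toHomeomorph.measurableEmbedding]
  simp

theorem lintegral_plane_exp_neg_mul_rpow {α b : ℝ} (hα : 1 ≤ α) (hb : 0 < b) :
    ∫⁻ q : Plane, ENNReal.ofReal (Real.exp (-b * ‖q‖ ^ α)) =
      ENNReal.ofReal (Real.pi * b ^ (-2 / α) * Real.Gamma (2 / α + 1)) := by
  have hpos : 0 < Real.pi * b ^ (-2 / α) * Real.Gamma (2 / α + 1) := by
    have := Real.Gamma_pos_of_pos (s := 2 / α + 1) (by positivity)
    positivity
  have hi : Integrable fun q : Plane => Real.exp (-b * ‖q‖ ^ α) := by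
    -- A non-integrable function has integral `0` by convention, but the value found is positive.
    by_contra h
    have := integral_undef h
    rw [integral_plane_exp_neg_mul_rpow hα hb] at this
    exact hpos.ne' this
  rw [← ofReal_integral_eq_lintegral_ofReal hi (.of_forall fun q => (Real.exp_pos _).le),
    integral_plane_exp_neg_mul_rpow hα hb]

theorem lintegral_exp_neg_mul_rpow_Ioi {a : ℝ} (ha : a < 1) :
    ∫⁻ t in Set.Ioi (0 : ℝ), ENNReal.ofReal (Real.exp (-t) * t ^ (-a)) =
      ENNReal.ofReal (Real.Gamma (1 - a)) := by
  have h := Real.GammaIntegral_convergent (s := 1 - a) (by linarith)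
  rw [Real.Gamma_eq_integral (by linarith), ofReal_integral_eq_lintegral_ofReal h]
  · ring_nf
  · filter_upwards [ae_restrict_mem measurableSet_Ioi] with t ht
    have := Set.mem_Ioi.1 ht
    positivity

theorem ofReal_inv_one_add_eq_lintegral {b : ℝ} (hb : 0 ≤ b) :
    ENNReal.ofReal (1 + b)⁻¹ =
      ∫⁻ t in Set.Ioi (0 : ℝ), ENNReal.ofReal (Real.exp (-t) * Real.exp (-(t * b))) := by
  have h1 : ∀ t, Real.exp (-t) * Real.exp (-(t * b)) = Real.exp (-(1 + b) * t) := fun t => by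
    rw [← Real.exp_add]
    ring_nf
  simp_rw [h1]
  rw [← ofReal_integral_eq_lintegral_ofReal
    (integrableOn_exp_mul_Ioi (by linarith) 0) (.of_forall fun q => (Real.exp_pos _).le),
    integral_exp_mul_Ioi (by linarith), mul_zero, Real.exp_zero, neg_div_neg_eq, one_div]

/-- Write the integrand as a Laplace transform in `t` and apply Tonelli. The plane integral gives
`Γ(2/α + 1)` times a constant multiple of `t ^ (-(2 / α))`; the integral in `t` gives `Γ(1 - 2/α)`,
which needs `α > 2`. -/
theorem lintegral_plane_inv_one_add_rpow {α s : ℝ} (hα : 2 < α) (hs : 0 < s) :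
    ∫⁻ q : Plane, ENNReal.ofReal (1 + ‖q‖ ^ α / s)⁻¹ =
      ENNReal.ofReal (2 * Real.pi ^ 2 * s ^ (2 / α) / (α * Real.sin (2 / α * Real.pi))) := by
  have ha : 2 / α < 1 := (div_lt_one (by linarith)).2 hα
  have ha0 : 0 < 2 / α := by positivity
  have hG := Real.Gamma_pos_of_pos (s := 2 / α + 1) (by positivity)
  have h1 : ∀ q : Plane, ENNReal.ofReal (1 + ‖q‖ ^ α / s)⁻¹ = ∫⁻ t in Set.Ioi (0 : ℝ),
      ENNReal.ofReal (Real.exp (-t) * Real.exp (-(t * (‖q‖ ^ α / s)))) := fun q =>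
    ofReal_inv_one_add_eq_lintegral (by positivity)
  simp_rw [h1]
  rw [lintegral_lintegral_swap (by fun_prop)]
  have h2 : ∀ t ∈ Set.Ioi (0 : ℝ), ∫⁻ q : Plane,
      ENNReal.ofReal (Real.exp (-t) * Real.exp (-(t * (‖q‖ ^ α / s)))) =
      ENNReal.ofReal (Real.pi * s ^ (2 / α) * Real.Gamma (2 / α + 1)) *
        ENNReal.ofReal (Real.exp (-t) * t ^ (-(2 / α))) := by
    intro t ht
    have ht : 0 < t := ht
    have h3 : ∀ q : Plane, -(t * (‖q‖ ^ α / s)) = -(t / s) * ‖q‖ ^ α := fun q => by ring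
    simp_rw [h3, ENNReal.ofReal_mul (Real.exp_pos (-t)).le]
    rw [lintegral_const_mul' _ _ ENNReal.ofReal_ne_top,
      lintegral_plane_exp_neg_mul_rpow (by linarith) (by positivity),
      ← ENNReal.ofReal_mul (by positivity), ← ENNReal.ofReal_mul (by positivity),
      ← ENNReal.ofReal_mul (by positivity), neg_div, Real.div_rpow ht.le hs.le,
      Real.rpow_neg hs.le]
    congr 1
    field_simp
  rw [setLIntegral_congr_fun measurableSet_Ioi h2, lintegral_const_mul' _ _ ENNReal.ofReal_ne_top,
    lintegral_exp_neg_mul_rpow_Ioi ha, ← ENNReal.ofReal_mul (by positivity)]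
  congr 1
  -- Euler's reflection formula produces the sine.
  have hr := Real.Gamma_mul_Gamma_one_sub (2 / α)
  rw [Real.Gamma_add_one ha0.ne', show Real.pi * s ^ (2 / α) * (2 / α * Real.Gamma (2 / α)) *
    Real.Gamma (1 - 2 / α) = Real.pi * s ^ (2 / α) * (2 / α) *
      (Real.Gamma (2 / α) * Real.Gamma (1 - 2 / α)) by ring, hr, mul_comm Real.pi (2 / α)]
  have hsin : 0 < Real.sin (2 / α * Real.pi) :=
    Real.sin_pos_of_pos_of_lt_pi (by positivity) (by nlinarith [Real.pi_pos])
  field_simp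

/-- The expected loss of the link success probability caused by one interferer at `q`. -/
noncomputable def interferenceLoss (α s : ℝ) (q : Plane) : ℝ :=
  s * ‖q‖ ^ (-α) / (1 + s * ‖q‖ ^ (-α))

theorem measurable_interferenceLoss (α s : ℝ) : Measurable (interferenceLoss α s) := by
  unfold interferenceLoss
  fun_prop

theorem interferenceLoss_nonneg {α s : ℝ} (hs : 0 ≤ s) (q : Plane) :
    0 ≤ interferenceLoss α s q := by
  unfold interferenceLoss
  positivity

theorem interferenceLoss_le_one {α s : ℝ} (hs : 0 ≤ s) (q : Plane) :
    interferenceLoss α s q ≤ 1 := by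
  unfold interferenceLoss
  exact div_le_one_of_le₀ (by linarith) (by positivity)

theorem one_sub_interferenceLoss {α s : ℝ} (hs : 0 ≤ s) (q : Plane) :
    1 - interferenceLoss α s q = (1 + s * ‖q‖ ^ (-α))⁻¹ := by
  unfold interferenceLoss
  have : 0 < 1 + s * ‖q‖ ^ (-α) := by positivity
  field_simp
  ring

theorem integrable_interferenceLoss_and_integral_eq {α s : ℝ} (hα : 2 < α) (hs : 0 ≤ s) :
    Integrable (interferenceLoss α s) ∧ ∫ q, interferenceLoss α s q =
      2 * Real.pi ^ 2 * s ^ (2 / α) / (α * Real.sin (2 / α * Real.pi)) := by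
  have ha0 : 0 < 2 / α := by positivity
  rcases hs.eq_or_lt with rfl | hs'
  · have : interferenceLoss α 0 = fun _ => 0 := by
      ext q
      simp [interferenceLoss]
    simp [this, Real.zero_rpow ha0.ne']
  have hsin : 0 < Real.sin (2 / α * Real.pi) :=
    Real.sin_pos_of_pos_of_lt_pi (by positivity)
      (by nlinarith [Real.pi_pos, (div_lt_one (by linarith)).2 hα])
  -- The origin is excluded: there `0 ^ (-α) = 0`, so the left side is `0` and the right side is
  -- `1`.
  have hae : ∀ᵐ q : Plane, interferenceLoss α s q = (1 + ‖q‖ ^ α / s)⁻¹ := by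
    filter_upwards [compl_mem_ae_iff.2 (measure_singleton (0 : Plane))] with q hq
    have hq : 0 < ‖q‖ := norm_pos_iff.2 hq
    have := Real.rpow_pos_of_pos hq α
    rw [interferenceLoss, Real.rpow_neg hq.le]
    field_simp
    ring
  have hl : ∫⁻ q, ENNReal.ofReal (interferenceLoss α s q) =
      ENNReal.ofReal (2 * Real.pi ^ 2 * s ^ (2 / α) / (α * Real.sin (2 / α * Real.pi))) := by
    rw [← lintegral_plane_inv_one_add_rpow hα hs']
    exact lintegral_congr_ae (hae.mono fun q hq => congrArg ENNReal.ofReal hq)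
  have hm := (measurable_interferenceLoss α s).aestronglyMeasurable (μ := volume)
  constructor
  · refine ⟨hm, ?_⟩
    rw [hasFiniteIntegral_iff_ofReal (.of_forall (interferenceLoss_nonneg hs)), hl]
    exact ENNReal.ofReal_lt_top
  · rw [integral_eq_lintegral_of_nonneg_ae (.of_forall (interferenceLoss_nonneg hs)) hm, hl,
      ENNReal.toReal_ofReal (by positivity)]

end PathLoss

/-! ### The connection probability. -/

section Connection

open Filter Topology

theorem ae_pos_of_hasLaw_exp {Ω : Type*} [MeasurableSpace Ω] {μ : Measure Ω}
    [IsProbabilityMeasure μ] {X : Ω → ℝ} (hX : HasLaw X (expMeasure 1) μ) (hm : Measurable X) :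
    ∀ᵐ ω ∂μ, 0 < X ω := by
  have h0 : ∀ᵐ t ∂(expMeasure 1), t ≠ 0 :=
    (withDensity_absolutelyContinuous volume (gammaPDF 1 1)).ae_le
      (compl_mem_ae_iff.2 (measure_singleton (0 : ℝ)))
  rw [← hX.map_eq] at h0
  filter_upwards [ae_of_ae_map hm.aemeasurable h0, ae_nonneg_of_hasLaw_exp hX hm] with ω h1 h2
  exact lt_of_le_of_ne h2 (Ne.symm h1)

/-- This makes the SINR event a countable intersection of events with finitely many interferers. -/
theorem ENNReal.mul_tsum_add_le_iff {a b c : ℝ≥0∞} (ha : a ≠ ∞) (f : ℕ → ℝ≥0∞) :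
    a * (∑' i, f i + b) ≤ c ↔ ∀ n, a * (∑ i ∈ Finset.range n, f i + b) ≤ c := by
  refine ⟨fun h n => le_trans ?_ h, fun h => ?_⟩
  · gcongr
    exact ENNReal.sum_le_tsum _
  · have := ENNReal.Tendsto.const_mul (a := a)
      ((ENNReal.summable (f := f)).hasSum.tendsto_sum_nat.add_const b) (.inr ha)
    exact le_of_tendsto' this h

/-- Clearing denominators in the SINR condition with finitely many interferers. -/
theorem mul_sum_add_le_iff_of_fading {Pt α σ2 βP r : ℝ} (hPt : 0 < Pt) (hr : 0 < r)
    (hσ2 : 0 ≤ σ2) (hβP : 0 ≤ βP) {g : ℕ → ℝ} (hg : ∀ i, 0 ≤ g i) (q : ℕ → Plane)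
    (d : ℕ → Bool) (n : ℕ) :
    ENNReal.ofReal βP * (∑ i ∈ Finset.range n, (if d (i + 1) = true then
        ENNReal.ofReal (Pt * g (i + 1) * ‖q (i + 1)‖ ^ (-α)) else 0) + ENNReal.ofReal σ2) ≤
      ENNReal.ofReal (Pt * g 0 * r ^ (-α)) ↔
    βP * (σ2 / Pt) * r ^ α + ∑ i ∈ Finset.range n, (if d (i + 1) = true then
      βP * r ^ α * ‖q (i + 1)‖ ^ (-α) else 0) * g (i + 1) ≤ g 0 := by
  have h1 : ∀ i, (if d (i + 1) = true then
      ENNReal.ofReal (Pt * g (i + 1) * ‖q (i + 1)‖ ^ (-α)) else 0) =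
      ENNReal.ofReal (if d (i + 1) = true then Pt * g (i + 1) * ‖q (i + 1)‖ ^ (-α) else 0) :=
    fun i => by split_ifs <;> simp
  have h2 : ∀ i, 0 ≤ (if d (i + 1) = true then Pt * g (i + 1) * ‖q (i + 1)‖ ^ (-α) else 0) :=
    fun i => by
      have := hg (i + 1)
      split_ifs <;> positivity
  have h3 := hg 0
  have hrα : 0 < r ^ α := by positivity
  simp_rw [h1]
  rw [← ENNReal.ofReal_sum_of_nonneg fun i _ => h2 i,
    ← ENNReal.ofReal_add (Finset.sum_nonneg fun i _ => h2 i) hσ2, ← ENNReal.ofReal_mul hβP,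
    ENNReal.ofReal_le_ofReal_iff (by positivity), Real.rpow_neg hr.le]
  have h4 : βP * (σ2 / Pt) * r ^ α + ∑ i ∈ Finset.range n, (if d (i + 1) = true then
      βP * r ^ α * ‖q (i + 1)‖ ^ (-α) else 0) * g (i + 1) =
      βP * (∑ i ∈ Finset.range n, (if d (i + 1) = true then
        Pt * g (i + 1) * ‖q (i + 1)‖ ^ (-α) else 0) + σ2) * (r ^ α / Pt) := by
    rw [mul_add, add_mul, add_comm, Finset.mul_sum, Finset.sum_mul]
    congr 1
    · refine Finset.sum_congr rfl fun i _ => ?_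
      split_ifs
      · field_simp
      · simp
    · field_simp
  rw [h4, ← div_eq_mul_inv, le_div_iff₀ hrα, ← mul_div_assoc, div_le_iff₀ hPt, mul_comm (g 0)]

variable {Ω : Type*} [MeasurableSpace Ω] {μ : Measure Ω} [IsProbabilityMeasure μ]
  {lamP lamS rg r₁ Pt α σ2 βP : ℝ} {x₁ : Plane} {ΦS : Ω → Set Plane}
  {x : ℕ → Ω → Plane} {h : ℕ → Ω → ℝ} {δ : ℕ → Ω → Bool}

namespace IsIndependentActivityNetwork

/-- Gains are integrated out first, with positions and marks fixed, and marks second, with positions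
fixed. The typical transmitter's own mark is one more independent factor and contributes `p`. -/
theorem measureReal_active_and_sum_le_gain
    (hnet : IsIndependentActivityNetwork μ lamP lamS rg x₁ ΦS x h δ) {b s : ℝ} (hb : 0 ≤ b)
    (hs : 0 ≤ s) (n : ℕ) :
    μ.real {ω | δ 0 ω = true ∧ b + ∑ i ∈ Finset.range n,
        (if δ (i + 1) ω = true then s * ‖x (i + 1) ω‖ ^ (-α) else 0) * h (i + 1) ω ≤ h 0 ω} =
      Real.exp (-b) * (activeProb μ rg x₁ ΦS * ∫ ω, ∏ i ∈ Finset.range n,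
        (1 - activeProb μ rg x₁ ΦS * interferenceLoss α s (x (i + 1) ω)) ∂μ) := by
  set p := activeProb μ rg x₁ ΦS with hp
  have hxm := measurable_pi_lambda _ hnet.measurable_x
  have hhm := measurable_pi_lambda _ hnet.measurable_h
  have hδm := measurable_pi_lambda _ hnet.measurable_δ
  have hxδ : IndepFun (fun ω i => x i ω) (fun ω i => δ i ω) μ :=
    hnet.indep_x_hδ.comp (φ := id) (ψ := Prod.snd) measurable_id measurable_snd
  have hind : IndepFun (fun ω => ((fun i => x i ω), (fun i => δ i ω))) (fun ω i => h i ω) μ :=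
    (indepFun_prodMk_of_indepFun_prodMk hxm hhm hδm hnet.indep_x_hδ hnet.indep_h_δ).symm
  let S : Set (((ℕ → Plane) × (ℕ → Bool)) × (ℕ → ℝ)) := {u | u.1.2 0 = true ∧
    b + ∑ i ∈ Finset.range n, (if u.1.2 (i + 1) = true then s * ‖u.1.1 (i + 1)‖ ^ (-α) else 0) *
      u.2 (i + 1) ≤ u.2 0}
  have hbool : ∀ i, MeasurableSet {u : ((ℕ → Plane) × (ℕ → Bool)) × (ℕ → ℝ) | u.1.2 i = true} :=
    fun i => (show Measurable fun u : ((ℕ → Plane) × (ℕ → Bool)) × (ℕ → ℝ) => u.1.2 i by fun_prop)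
      (measurableSet_singleton true)
  have hhi := hnet.measurable_h
  have hS : MeasurableSet S := by
    have hterm : ∀ i, Measurable fun u : ((ℕ → Plane) × (ℕ → Bool)) × (ℕ → ℝ) =>
        (if u.1.2 (i + 1) = true then s * ‖u.1.1 (i + 1)‖ ^ (-α) else 0) * u.2 (i + 1) := fun i =>
      (Measurable.ite (hbool _) (by fun_prop) measurable_const).mul (by fun_prop)
    exact (hbool 0).inter (measurableSet_le (measurable_const.add
      (Finset.measurable_fun_sum _ fun i _ => hterm i)) (by fun_prop))
  have hpre : MeasurableSet {ω | δ 0 ω = true ∧ b + ∑ i ∈ Finset.range n,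
      (if δ (i + 1) ω = true then s * ‖x (i + 1) ω‖ ^ (-α) else 0) * h (i + 1) ω ≤ h 0 ω} :=
    ((hxm.prodMk hδm).prodMk hhm) hS
  have h1 := integral_comp_prodMk_of_indepFun (𝕜 := ℝ) (hxm.prodMk hδm) hhm hind
    (f := fun u v => S.indicator (fun _ => (1 : ℝ)) (u, v)) (measurable_const.indicator hS) (c := 1)
    (fun u v => by by_cases hu : (u, v) ∈ S <;> simp [hu])
  -- Index `0` carries the activity indicator, the others the Laplace factors of active interferers.
  have h2 : ∀ ω, ∫ ω', S.indicator (fun _ => (1 : ℝ)) (((fun i => x i ω), (fun i => δ i ω)),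
      (fun i => h i ω')) ∂μ = Real.exp (-b) * ∏ i ∈ Finset.range (n + 1),
        (if i = 0 then (if δ i ω = true then 1 else 0) else
          (if δ i ω = true then (1 + s * ‖x i ω‖ ^ (-α))⁻¹ else 1)) := fun ω => by
    rw [Finset.prod_range_succ', if_pos rfl]
    by_cases h0 : δ 0 ω = true
    · have h3 := measureReal_add_sum_le_exp hnet.measurable_h hnet.law_h hnet.indep_h hb
        (a := fun i => if δ (i + 1) ω = true then s * ‖x (i + 1) ω‖ ^ (-α) else 0)
        (fun i => by split_ifs <;> positivity) n
      rw [← integral_indicator_one (measurableSet_le (by fun_prop) (hnet.measurable_h 0))] at h3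
      rw [if_pos h0, mul_one]
      refine Eq.trans ?_ (h3.trans ?_)
      · congr 1 with ω'
        simp only [Set.indicator, S, Set.mem_ofPred_eq, h0, true_and]
        rfl
      · congr 1
        refine Finset.prod_congr rfl fun i _ => ?_
        rw [if_neg (Nat.succ_ne_zero i)]
        split_ifs <;> simp
    · rw [if_neg h0, mul_zero, mul_zero]
      refine integral_eq_zero_of_ae (.of_forall fun ω' => ?_)
      exact Set.indicator_of_notMem (fun hmem => h0 hmem.1) _
  simp_rw [h2] at h1
  rw [integral_const_mul, integral_finset_prod_marks (𝕜 := ℝ) hxm hnet.measurable_δ hnet.indep_δ hxδ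
    (Finset.range (n + 1)) (f := fun i (a : ℕ → Plane) (c : Bool) =>
      if i = 0 then (if c = true then 1 else 0) else
        (if c = true then (1 + s * ‖a i‖ ^ (-α))⁻¹ else 1))] at h1
  · rw [← integral_indicator_one hpre]
    refine Eq.trans ?_ (h1.trans ?_)
    · rfl
    congr 1
    rw [← integral_const_mul]
    congr 1 with ω
    rw [Finset.prod_range_succ', mul_comm]
    congr 1
    · simp only [if_true]
      have hδ0 : MeasurableSet {ω | δ 0 ω = true} :=
        hnet.measurable_δ 0 (measurableSet_singleton true)
      rw [hp, ← hnet.prob_δ 0, ← integral_indicator_one hδ0]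
      congr 1 with ω'
      by_cases h0 : δ 0 ω' = true <;> simp [h0]
    · refine Finset.prod_congr rfl fun i _ => ?_
      simp only [Nat.succ_ne_zero, if_false]
      rw [integral_ite_eq_true (hnet.measurable_δ (i + 1)), hnet.prob_δ,
        ← one_sub_interferenceLoss hs]
      simp only [RCLike.ofReal_real_eq_id, id_eq]
      ring
  · intro i
    have hc : MeasurableSet {q : (ℕ → Plane) × Bool | q.2 = true} :=
      measurable_snd (measurableSet_singleton true)
    by_cases hi : i = 0
    · simp only [hi, if_true]
      exact Measurable.ite hc measurable_const measurable_const
    · simp only [hi, if_false]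
      exact Measurable.ite hc (by fun_prop) measurable_const
  · intro i a c
    have : 0 ≤ s * ‖a i‖ ^ (-α) := by positivity
    have : (1 + s * ‖a i‖ ^ (-α))⁻¹ ≤ 1 := inv_le_one_of_one_le₀ (by linarith)
    have : 0 ≤ (1 + s * ‖a i‖ ^ (-α))⁻¹ := by positivity
    rw [Real.norm_eq_abs, abs_le]
    constructor <;> split_ifs <;> linarith

theorem connProb_eq (hnet : IsIndependentActivityNetwork μ lamP lamS rg x₁ ΦS x h δ)
    (hlamP : 0 ≤ lamP) (hr₁ : 0 < r₁) (hPt : 0 < Pt) (hα : 2 < α) (hσ2 : 0 ≤ σ2) (hβP : 0 ≤ βP)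
    (hx₁ : ‖x₁‖ = r₁) :
    connProb μ Pt α σ2 βP rg ΦS x₁ x h δ = activeProb μ rg x₁ ΦS *
      Real.exp (-(βP * (σ2 / Pt) * r₁ ^ α + 2 * Real.pi ^ 2 * lamP * activeProb μ rg x₁ ΦS *
        βP ^ (2 / α) * r₁ ^ 2 / (α * Real.sin (2 / α * Real.pi)))) := by
  set p := activeProb μ rg x₁ ΦS with hp
  set b := βP * (σ2 / Pt) * r₁ ^ α with hb
  set s := βP * r₁ ^ α with hs
  have hs0 : 0 ≤ s := by positivity
  have hb0 : 0 ≤ b := by positivity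
  have hp0 : 0 ≤ p := measureReal_nonneg
  have hp1 : p ≤ 1 := measureReal_le_one
  let A : ℕ → Set Ω := fun n => {ω | δ 0 ω = true ∧ ENNReal.ofReal βP *
    (∑ i ∈ Finset.range n, (if δ (i + 1) ω = true then
      ENNReal.ofReal (Pt * h (i + 1) ω * ‖x (i + 1) ω‖ ^ (-α)) else 0) + ENNReal.ofReal σ2) ≤
        ENNReal.ofReal (Pt * h 0 ω * r₁ ^ (-α))}
  have hbool : ∀ i, MeasurableSet {ω | δ i ω = true} := fun i =>
    hnet.measurable_δ i (measurableSet_singleton true)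
  have hxm := hnet.measurable_x
  have hhm := hnet.measurable_h
  have hA : ∀ n, MeasurableSet (A n) := fun n => by
    have hterm : ∀ i, Measurable fun ω => (if δ (i + 1) ω = true then
        ENNReal.ofReal (Pt * h (i + 1) ω * ‖x (i + 1) ω‖ ^ (-α)) else 0) := fun i =>
      Measurable.ite (hbool _) (by fun_prop) measurable_const
    exact (hbool 0).inter (measurableSet_le (measurable_const.mul (Measurable.add
      (Finset.measurable_fun_sum _ fun i _ => hterm i) measurable_const)) (by fun_prop))
  have hanti : Antitone A := fun m n hmn ω hω => ⟨hω.1, le_trans (by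
    gcongr) hω.2⟩
  have hpos : ∀ᵐ ω ∂μ, ∀ i, 0 < h i ω :=
    ae_all_iff.2 fun i => ae_pos_of_hasLaw_exp (hnet.law_h i) (hhm i)
  have hconn : connProb μ Pt α σ2 βP rg ΦS x₁ x h δ = μ.real (⋂ n, A n) := by
    refine measureReal_congr ?_
    filter_upwards [hpos] with ω hω
    refine propext ?_
    change (ENNReal.ofReal rg ≤ nearestERDist x₁ ΦS ω ∧
      ENNReal.ofReal βP ≤ sinrP Pt α σ2 x h δ ω) ↔ ω ∈ ⋂ n, A n
    -- A positive finite numerator allows clearing the denominator even when the latter is `0` or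
    -- `∞`.
    have hnum : 0 < Pt * h 0 ω * r₁ ^ (-α) := by
      have := hω 0
      positivity
    rw [sinrP, hnet.x_zero, hx₁, ENNReal.le_div_iff_mul_le
      (.inr (ENNReal.ofReal_pos.2 hnum).ne') (.inr ENNReal.ofReal_ne_top),
      ENNReal.mul_tsum_add_le_iff ENNReal.ofReal_ne_top, ← hnet.δ_zero, Set.mem_iInter]
    exact (forall_and_left _ _).symm
  have hAn : ∀ n, μ.real (A n) = Real.exp (-b) * (p * ∫ ω, ∏ i ∈ Finset.range n,
      (1 - p * interferenceLoss α s (x (i + 1) ω)) ∂μ) := fun n => by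
    rw [← hnet.measureReal_active_and_sum_le_gain hb0 hs0 n]
    refine measureReal_congr ?_
    filter_upwards [hpos] with ω hω
    exact propext (and_congr_right fun _ =>
      mul_sum_add_le_iff_of_fading hPt hr₁ hσ2 hβP (fun i => (hω i).le) (fun i => x i ω)
        (fun i => δ i ω) n)
  obtain ⟨hint, heq⟩ := integrable_interferenceLoss_and_integral_eq hα hs0
  have hlim := hnet.ppp_P.tendsto_integral_prod hlamP (fun i => hxm (i + 1)) hnet.inj_x
    (u := fun q => p * interferenceLoss α s q)
    ((measurable_interferenceLoss α s).const_mul p)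
    (fun q => mul_nonneg hp0 (interferenceLoss_nonneg hs0 q))
    (fun q => mul_le_one₀ hp1 (interferenceLoss_nonneg hs0 q) (interferenceLoss_le_one hs0 q))
    (hint.const_mul p)
  -- Continuity from above, for the decreasing events `A n`.
  have hlimA : Tendsto (fun n => μ.real (A n)) atTop (𝓝 (μ.real (⋂ n, A n))) :=
    (ENNReal.tendsto_toReal (measure_ne_top _ _)).comp
      (tendsto_measure_iInter_atTop (fun n => (hA n).nullMeasurableSet) hanti
        ⟨0, measure_ne_top _ _⟩)
  simp_rw [hAn] at hlimA
  rw [hconn, tendsto_nhds_unique hlimA ((hlim.const_mul p).const_mul (Real.exp (-b))),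
    integral_const_mul, heq]
  have hspow : s ^ (2 / α) = βP ^ (2 / α) * r₁ ^ 2 := by
    rw [hs, Real.mul_rpow hβP (by positivity), ← Real.rpow_mul hr₁.le,
      mul_div_cancel₀ _ (by linarith), Real.rpow_two]
  rw [hspow, neg_add, Real.exp_add, mul_left_comm]
  congr 3
  ring_nf

end IsIndependentActivityNetwork

end Connection

theorem theorem1 {Ω : Type*} [MeasurableSpace Ω] (μ : Measure Ω) [IsProbabilityMeasure μ]
    (lamP lamS rg r₁ Pt α σ2 βP : ℝ)
    (hlamP : 0 < lamP) (hlamS : 0 ≤ lamS) (hrg : 0 ≤ rg) (hr₁ : 0 < r₁) (hPt : 0 < Pt)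
    (hα : 2 < α) (hσ2 : 0 ≤ σ2) (hβP : 0 ≤ βP)
    (x₁ : Plane) (hx₁ : ‖x₁‖ = r₁)
    (ΦS : Ω → Set Plane) (x : ℕ → Ω → Plane) (h : ℕ → Ω → ℝ) (δ : ℕ → Ω → Bool)
    (hnet : IsIndependentActivityNetwork μ lamP lamS rg x₁ ΦS x h δ) :
    activeProb μ rg x₁ ΦS = Real.exp (-(lamS * Real.pi * rg ^ 2)) ∧
    IsHomogeneousPPP μ (lamP * Real.exp (-(lamS * Real.pi * rg ^ 2)))
      (fun ω => {z : Plane | ∃ i : ℕ, δ (i + 1) ω = true ∧ x (i + 1) ω = z}) ∧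
    connProb μ Pt α σ2 βP rg ΦS x₁ x h δ =
      Real.exp (-(lamS * Real.pi * rg ^ 2 + βP * (σ2 / Pt) * r₁ ^ α +
        2 * Real.pi ^ 2 * lamP * activeProb μ rg x₁ ΦS * βP ^ (2 / α) * r₁ ^ 2 /
          (α * Real.sin (2 / α * Real.pi)))) := by
  have hact := activeProb_eq_exp hlamS hrg x₁ hnet.ppp_S
  refine ⟨hact, ?_, ?_⟩
  · have hind : IndepFun (fun ω i => x (i + 1) ω) (fun ω i => δ (i + 1) ω) μ :=
      hnet.indep_x_hδ.comp (φ := fun (a : ℕ → Plane) (i : ℕ) => a (i + 1))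
        (ψ := fun (q : (ℕ → ℝ) × (ℕ → Bool)) (i : ℕ) => q.2 (i + 1)) (by fun_prop) (by fun_prop)
    exact hnet.ppp_P.thinning (d := fun i => δ (i + 1)) hlamP.le
      (fun i => hnet.measurable_x (i + 1)) hnet.inj_x
      (fun i => hnet.measurable_δ (i + 1)) (hnet.indep_δ.precomp (add_left_injective 1)) hind
      fun i => (hnet.prob_δ (i + 1)).trans hact
  -- The prefactor `activeProb` is itself an exponential and supplies the first term of the
  -- exponent.
  · rw [hnet.connProb_eq hlamP.le hr₁ hPt hα hσ2 hβP hx₁, add_assoc (lamS * _ * _),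
      neg_add (lamS * _ * _), Real.exp_add, ← hact]
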